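/- A Tychonoff space is a completely regular Hausdorff space. For a Tychonoff space $Z$, let $C_p(Z)$ be the real vector space of all continuous functions $Z\to\mathbb{R}$ with the topology of pointwise convergence. A subset of a real locally convex space $E$ is a barrel if it is closed, absolutely convex and absorbing, and is barrel-bounded if it is absorbed by every barrel of $E$. Let $E'$ be the topological dual of $E$, let $\sigma(E',E)$ be its weak$^*$ topology, and let $\beta^*(E',E)$ be the topology on $E'$ of uniform convergence on the barrel-bounded subsets of $E$. The space $E$ has the Josefson--Nissenzweig property (JNP) if the identity map $(E',\sigma(E',E))\to(E',\beta^*(E',E))$ is not sequentially continuous. Let $X$ and $Y$ be infinite Tychonoff spaces, and let $\sigma$ be the weak topology on the set $X\times Y$ generated by all separately continuous functions $f\colon X\times Y\to\mathbb{R}$ (those for which $f(x,\cdot)$ is continuous on $Y$ for every $x\in X$ and $f(\cdot,y)$ is continuous on $X$ for every $y\in Y$). Then $C_p(X\times Y,\sigma)$ has the JNP if and only if $C_p(X)$ has the JNP or $C_p(Y)$ has the JNP. -/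

import Mathlib

open Topology

/-! ### The Josefson--Nissenzweig property -/

/-- A barrel in a real topological vector space: a closed, absolutely convex, absorbing set. -/
def IsBarrel {E : Type*} [AddCommGroup E] [Module ℝ E] [TopologicalSpace E] (U : Set E) : Prop :=
  IsClosed U ∧ AbsConvex ℝ U ∧ Absorbent ℝ U

/-- A set is barrel-bounded if it is absorbed by every barrel. -/
def IsBarrelBounded {E : Type*} [AddCommGroup E] [Module ℝ E] [TopologicalSpace E]
    (B : Set E) : Prop :=
  ∀ U : Set E, IsBarrel U → Absorbs ℝ U B

/-- The topological dual of `E` with the topology `β*(E', E)`: uniform convergence on the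
barrel-bounded subsets of `E`. -/
abbrev BetaStarDual (E : Type*) [AddCommGroup E] [Module ℝ E] [TopologicalSpace E] : Type _ :=
  UniformConvergenceCLM (RingHom.id ℝ) ℝ {B : Set E | IsBarrelBounded B}

/-- The identity map `(E', σ(E', E)) → (E', β*(E', E))`. -/
noncomputable def weakDualToBetaStarDual (E : Type*) [AddCommGroup E] [Module ℝ E] [TopologicalSpace E] :
    WeakDual ℝ E → BetaStarDual E :=
  fun φ => UniformConvergenceCLM.ofFun (RingHom.id ℝ) ℝ {B : Set E | IsBarrelBounded B}
    (WeakDual.toStrongDual φ)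

/-- A (real) locally convex space `E` has the Josefson--Nissenzweig property if the identity map
`(E', σ(E', E)) → (E', β*(E', E))` is not sequentially continuous. -/
def HasJNP (E : Type*) [AddCommGroup E] [Module ℝ E] [TopologicalSpace E]
    [IsTopologicalAddGroup E] [ContinuousSMul ℝ E] [LocallyConvexSpace ℝ E] : Prop :=
  ¬ SeqContinuous (weakDualToBetaStarDual E)

/-! ### Spaces of continuous functions with the pointwise topology -/

/-- The space `C_p(X)` of continuous real-valued functions on `X`, as a subspace of the product
`X → ℝ`; as such it carries the topology of pointwise convergence. -/
def Cp (X : Type*) [TopologicalSpace X] : Submodule ℝ (X → ℝ) where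
  carrier := {f | Continuous f}
  add_mem' hf hg := Continuous.add hf hg
  zero_mem' := continuous_zero
  smul_mem' c _ hf := Continuous.const_smul hf c

/-! ### The topology generated by the separately continuous functions -/

/-- A real-valued function on `X × Y` is separately continuous if it is continuous in each
variable when the other one is fixed. -/
def IsSeparatelyContinuous {X Y : Type*} [TopologicalSpace X] [TopologicalSpace Y]
    (f : X × Y → ℝ) : Prop :=
  (∀ x, Continuous fun y => f (x, y)) ∧ (∀ y, Continuous fun x => f (x, y))

/-- A copy of the set `X × Y`, to carry the topology `σ` instead of the product topology. -/
def ProdSigma (X Y : Type*) : Type _ := X × Y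

/-- The topology `σ` on `X × Y`: the weak (initial) topology generated by all separately
continuous functions `X × Y → ℝ`. -/
instance ProdSigma.instTopologicalSpace (X Y : Type*) [TopologicalSpace X] [TopologicalSpace Y] :
    TopologicalSpace (ProdSigma X Y) :=
  ⨅ f : {f : X × Y → ℝ // IsSeparatelyContinuous f}, TopologicalSpace.induced f.1 inferInstance

open Filter
open scoped Pointwise

/-! Everything reduces to finitely supported measures. Functionals on `C_p(Z)` are such measures,
and `hasJNP_Cp_iff` turns the JNP into the existence of a weak* null sequence of them that is not
null in the ℓ¹ norm. The reduction rests on two facts: the sup-norm unit ball is barrel-bounded, and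
the supports of a weak* null sequence have functionally bounded union, so that the polar of this
union is a barrel.

Sequences on `X` or `Y` transfer to the product along a line. Conversely, functionally bounded sets
for σ are very thin: sums of products of disjoint bumps are separately continuous and can be
unbounded along any sequence injective in both coordinates. Hence the measures live on finitely many
vertical and horizontal lines. If neither factor has such a sequence, the mass on each line away
from the crossing points tends to zero, and then so does the mass at each crossing point. -/

/-- A Josefson--Nissenzweig sequence on `Z`: the finitely supported signed measures
`∑ z ∈ s n, a n z • δ_z` converge to zero on every continuous function, but not in norm. -/
def HasJNSequence (Z : Type*) [TopologicalSpace Z] : Prop :=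
  ∃ (s : ℕ → Finset Z) (a : ℕ → Z → ℝ),
    (∀ f : Z → ℝ, Continuous f → Tendsto (fun n => ∑ z ∈ s n, a n z * f z) atTop (𝓝 0)) ∧
    ¬ Tendsto (fun n => ∑ z ∈ s n, |a n z|) atTop (𝓝 0)

/-! ### Pointwise bounded sequences of finitely supported measures -/

section

variable {Z : Type*} [TopologicalSpace Z] [T35Space Z]

theorem exists_continuous_bump (s : Finset Z) (z : Z) :
    ∃ f : Z → ℝ, Continuous f ∧ (∀ x, 0 ≤ f x ∧ f x ≤ 1) ∧ f z = 1 ∧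
      ∀ x ∈ s, x ≠ z → f x = 0 := by
  classical
  obtain ⟨f, hf, h0, h1⟩ := CompletelyRegularSpace.completely_regular z
    (↑(s.erase z) : Set Z) (s.erase z).finite_toSet.isClosed (by simp)
  refine ⟨fun x => 1 - f x, by fun_prop, fun x => ⟨?_, ?_⟩, by simp [h0], fun x hx hxz => ?_⟩
  · linarith [(f x).2.2]
  · linarith [(f x).2.1]
  · have := h1 (show x ∈ (↑(s.erase z) : Set Z) by simp [hx, hxz])
    simp [this]

theorem exists_continuous_interpolation (s : Finset Z) (g : Z → ℝ) (hg : ∀ z ∈ s, |g z| ≤ 1) :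
    ∃ f : Z → ℝ, Continuous f ∧ (∀ z, |f z| ≤ 1) ∧ ∀ z ∈ s, f z = g z := by
  choose u hu _ hu1 hu0 using exists_continuous_bump s
  refine ⟨fun x => max (-1) (min 1 (∑ z ∈ s, g z * u z x)), by fun_prop, fun z => ?_,
    fun z hz => ?_⟩
  · rw [abs_le]
    exact ⟨le_max_left _ _, max_le (by norm_num) (min_le_left _ _)⟩
  · have : ∑ x ∈ s, g x * u x z = g z := by
      rw [Finset.sum_eq_single_of_mem z hz fun x _ hx => by rw [hu0 x z hz hx.symm, mul_zero],
        hu1, mul_one]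
    have h := abs_le.1 (hg z hz)
    dsimp only
    rw [this, min_eq_right h.2, max_eq_right h.1]

theorem exists_continuous_sum_mul_eq_sum_abs (s : Finset Z) (a : Z → ℝ) :
    ∃ f : Z → ℝ, Continuous f ∧ (∀ z, |f z| ≤ 1) ∧ ∑ z ∈ s, a z * f z = ∑ z ∈ s, |a z| := by
  obtain ⟨f, hf, hf1, hfs⟩ := exists_continuous_interpolation s (fun z => SignType.sign (a z))
    (fun z _ => by rcases lt_trichotomy (a z) 0 with h | h | h <;> simp [h])
  refine ⟨f, hf, hf1, Finset.sum_congr rfl fun z hz => ?_⟩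
  rw [hfs z hz, self_mul_sign]

open BoundedContinuousFunction in
-- Banach–Steinhaus on the bounded continuous functions: interpolating the signs of the coefficients
-- shows that the functional norm dominates the ℓ¹ norm.
theorem exists_sum_abs_le_of_pointwise_bounded (s : ℕ → Finset Z) (a : ℕ → Z → ℝ)
    (hb : ∀ f : Z → ℝ, Continuous f → ∃ C, ∀ n, |∑ z ∈ s n, a n z * f z| ≤ C) :
    ∃ C, ∀ n, ∑ z ∈ s n, |a n z| ≤ C := by
  let φ : ℕ → (Z →ᵇ ℝ) →L[ℝ] ℝ := fun n => ∑ z ∈ s n, a n z • evalCLM ℝ z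
  have hφ : ∀ n f, φ n f = ∑ z ∈ s n, a n z * f z := fun n f => by
    simp [φ]
  obtain ⟨C, hC⟩ := banach_steinhaus (g := φ) fun f => by
    obtain ⟨C, hC⟩ := hb f f.continuous
    exact ⟨C, fun n => by rw [hφ]; exact hC n⟩
  refine ⟨C, fun n => ?_⟩
  obtain ⟨f, hf, hf1, hfs⟩ := exists_continuous_sum_mul_eq_sum_abs (s n) (a n)
  let F : Z →ᵇ ℝ := ofNormedAddCommGroup f hf 1 hf1
  have hF : ‖F‖ ≤ 1 := norm_ofNormedAddCommGroup_le _ zero_le_one _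
  have h2 : φ n F = ∑ z ∈ s n, |a n z| := by rw [hφ]; exact hfs
  rw [← h2]
  calc φ n F ≤ ‖φ n F‖ := le_abs_self _
    _ ≤ ‖φ n‖ * ‖F‖ := (φ n).le_opNorm F
    _ ≤ ‖φ n‖ * 1 := by gcongr
    _ ≤ C := by simpa using hC n

/-- Since `|t N| > N`, only finitely many constraints are active near a given point; local constant
solutions are glued by convexity. -/
theorem exists_continuous_real_ge (t b : ℕ → ℝ) (ht : ∀ N : ℕ, (N : ℝ) < |t N|) :
    ∃ w : ℝ → ℝ, Continuous w ∧ ∀ N, b N ≤ w (t N) := by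
  obtain ⟨w, hw⟩ := exists_continuous_forall_mem_convex_of_local_const
    (t := fun x : ℝ => {c : ℝ | ∀ N, t N = x → b N ≤ c})
    (fun x => by
      have : {c : ℝ | ∀ N, t N = x → b N ≤ c} = ⋂ N, ⋂ (_ : t N = x), Set.Ici (b N) := by
        ext; simp
      rw [this]
      exact convex_iInter fun N => convex_iInter fun _ => convex_Ici _)
    (fun x => by
      refine ⟨∑ N ∈ Finset.range (⌈|x| + 1⌉₊), |b N|, ?_⟩
      filter_upwards [Metric.ball_mem_nhds x one_pos] with y hy N hN
      rw [Metric.mem_ball, Real.dist_eq] at hy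
      have h1 : |y| < |x| + 1 := by
        have := abs_sub_abs_le_abs_sub y x
        linarith
      have h2 : N ∈ Finset.range ⌈|x| + 1⌉₊ := by
        rw [Finset.mem_range, Nat.lt_ceil]
        exact ((ht N).trans_eq (by rw [hN])).trans h1
      exact (le_abs_self _).trans
        (Finset.single_le_sum (f := fun N => |b N|) (fun _ _ => abs_nonneg _) h2))
  exact ⟨w, w.continuous, fun N => hw (t N) N rfl⟩

/-- The union of the supports of a pointwise bounded sequence of finitely supported measures is
functionally bounded. -/
theorem exists_abs_le_on_support (s : ℕ → Finset Z) (a : ℕ → Z → ℝ)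
    (hb : ∀ f : Z → ℝ, Continuous f → ∃ C, ∀ n, |∑ z ∈ s n, a n z * f z| ≤ C)
    (f : Z → ℝ) (hf : Continuous f) :
    ∃ C, ∀ n, ∀ z ∈ s n, a n z ≠ 0 → |f z| ≤ C := by
  by_contra! h
  choose n z hz ha hfz using fun N : ℕ => h N
  -- The weight `w ∘ f` lifts the `N`-th offending atom to mass at least `N`, while the weighted
  -- measures remain pointwise bounded.
  obtain ⟨w, hw, hwb⟩ := exists_continuous_real_ge (fun N => f (z N))
    (fun N => N / |a (n N) (z N)|) hfz
  obtain ⟨C, hC⟩ := exists_sum_abs_le_of_pointwise_bounded s (fun n z => a n z * w (f z))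
    (fun g hg => by
      simpa only [mul_assoc] using hb (fun z => w (f z) * g z) (by fun_prop))
  obtain ⟨N, hN⟩ := exists_nat_gt C
  have h1 := Finset.single_le_sum (f := fun z => |a (n N) z * w (f z)|)
    (fun _ _ => abs_nonneg _) (hz N)
  have h2 := h1.trans (hC (n N))
  have h3 := hwb N
  have h4 := abs_pos.2 (ha N)
  rw [div_le_iff₀ h4] at h3
  rw [abs_mul, mul_comm] at h2
  have h5 : w (f (z N)) * |a (n N) (z N)| ≤ |w (f (z N))| * |a (n N) (z N)| := by
    gcongr; exact le_abs_self _
  linarith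

end

/-! ### Barrels and the reduction of the JNP to measures -/

theorem hasJNP_iff_exists_seq (E : Type*) [AddCommGroup E] [Module ℝ E] [TopologicalSpace E]
    [IsTopologicalAddGroup E] [ContinuousSMul ℝ E] [LocallyConvexSpace ℝ E] :
    HasJNP E ↔ ∃ φ : ℕ → StrongDual ℝ E, (∀ x, Tendsto (fun n => φ n x) atTop (𝓝 0)) ∧
      ∃ B : Set E, IsBarrelBounded B ∧ ¬ TendstoUniformlyOn (fun n x => φ n x) 0 atTop B := by
  unfold HasJNP SeqContinuous
  simp only [weakDualToBetaStarDual, Function.comp_def,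
    UniformConvergenceCLM.tendsto_iff_tendstoUniformlyOn,
    tendsto_iff_forall_eval_tendsto_topDualPairing]
  constructor
  · intro h
    push Not at h
    obtain ⟨φ, ψ, hφ, B, hB, hn⟩ := h
    refine ⟨fun n => WeakDual.toStrongDual (φ n) - WeakDual.toStrongDual ψ, fun x => ?_, B, hB,
      fun hu => hn ?_⟩
    · have h := (hφ x).sub_const (ψ x)
      rwa [show topDualPairing ℝ E ψ x = ψ x from rfl, sub_self] at h
    · rw [Metric.tendstoUniformlyOn_iff] at hu ⊢
      intro ε hε
      filter_upwards [hu ε hε] with n hn x hx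
      have := hn x hx
      simp only [Pi.zero_apply, dist_zero_left] at this
      rw [dist_comm, dist_eq_norm]
      exact this
  · rintro ⟨φ, hφ, B, hB, hn⟩ h
    exact hn (h (x := fun n => StrongDual.toWeakDual (φ n)) (p := 0)
      (fun x => hφ x) B hB)

/-- By Baire some dilate of `U`, hence `U` itself, has an interior point `x`; by symmetry `-x` is
one too, and convexity makes their midpoint `0` interior. -/
theorem IsBarrel.mem_nhds_zero {E : Type*} [AddCommGroup E] [Module ℝ E] [TopologicalSpace E]
    [IsTopologicalAddGroup E] [ContinuousSMul ℝ E] [BaireSpace E] {U : Set E} (hU : IsBarrel U) :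
    U ∈ 𝓝 0 := by
  obtain ⟨hc, ⟨hb, hconv⟩, ha⟩ := hU
  have hn : ∀ n : ℕ, (n + 1 : ℝ) ≠ 0 := fun n => by positivity
  obtain ⟨n, hne⟩ := nonempty_interior_of_iUnion_of_closed (f := fun n : ℕ => (n + 1 : ℝ) • U)
    (fun n => hc.smul_of_ne_zero (hn n)) (by
      rw [Set.eq_univ_iff_forall]
      intro x
      have h1 : Tendsto (fun n : ℕ => (n + 1 : ℝ)) atTop (Bornology.cobounded ℝ) := by
        rw [IsOrderBornology.cobounded_eq]
        exact (tendsto_atTop_add_const_right _ _ tendsto_natCast_atTop_atTop).mono_right le_sup_right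
      obtain ⟨n, h⟩ := (h1.eventually (ha x)).exists
      exact Set.mem_iUnion.2 ⟨n, h rfl⟩)
  rw [interior_smul₀ (hn n), Set.smul_set_nonempty] at hne
  obtain ⟨x, hx⟩ := hne
  have hx' : -x ∈ interior U := by
    have h := (Homeomorph.neg E).preimage_interior U
    rw [show Homeomorph.neg E ⁻¹' U = U from Set.ext fun y => hb.neg_mem_iff] at h
    rw [← h] at hx
    exact hx
  have := hconv.interior hx hx' (show (0 : ℝ) ≤ 1 / 2 by norm_num) (show (0 : ℝ) ≤ 1 / 2 by norm_num)
    (by norm_num)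
  rw [smul_neg, add_neg_cancel] at this
  exact mem_interior_iff_mem_nhds.1 this

theorem IsBarrel.preimage {E F : Type*} [AddCommGroup E] [Module ℝ E] [TopologicalSpace E]
    [AddCommGroup F] [Module ℝ F] [TopologicalSpace F] {U : Set F} (hU : IsBarrel U)
    (T : E →L[ℝ] F) : IsBarrel (T ⁻¹' U) := by
  obtain ⟨hc, ⟨hb, hconv⟩, ha⟩ := hU
  refine ⟨hc.preimage T.continuous, ⟨?_, hconv.linear_preimage T.toLinearMap⟩, fun x => ?_⟩
  · intro a ha
    rintro _ ⟨x, hx, rfl⟩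
    simp only [Set.mem_preimage, map_smul]
    exact hb a ha ⟨T x, hx, rfl⟩
  · filter_upwards [ha (T x), Bornology.eventually_ne_cobounded (0 : ℝ)] with c hc hc0
    rw [Set.singleton_subset_iff, Set.mem_smul_set_iff_inv_smul_mem₀ hc0] at hc ⊢
    simpa using hc

section

variable {Z : Type*} [TopologicalSpace Z]

theorem Cp.continuous_eval (z : Z) : Continuous fun f : Cp Z => f.1 z :=
  (continuous_apply z).comp continuous_subtype_val

open BoundedContinuousFunction in
/-- The inclusion of the Banach space of bounded continuous functions into `C_p(Z)`. -/
noncomputable def Cp.ofBounded (Z : Type*) [TopologicalSpace Z] : (Z →ᵇ ℝ) →L[ℝ] Cp Z where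
  toFun f := ⟨f, f.continuous⟩
  map_add' _ _ := rfl
  map_smul' _ _ := rfl
  cont := Continuous.subtype_mk (continuous_pi fun z => continuous_eval_const z) _

open BoundedContinuousFunction in
theorem Cp.isBarrelBounded_unitBall : IsBarrelBounded {f : Cp Z | ∀ z, |f.1 z| ≤ 1} := by
  intro U hU
  have h1 := (hU.preimage (Cp.ofBounded Z)).mem_nhds_zero
  have h2 : Absorbs ℝ (Cp.ofBounded Z ⁻¹' U) (Metric.closedBall 0 1) :=
    (NormedSpace.isVonNBounded_closedBall ℝ (Z →ᵇ ℝ) 1) h1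
  filter_upwards [h2, Bornology.eventually_ne_cobounded (0 : ℝ)] with c hc hc0 f hf
  let F : Z →ᵇ ℝ := ofNormedAddCommGroup f.1 f.2 1 hf
  have hF : F ∈ Metric.closedBall (0 : Z →ᵇ ℝ) 1 := by
    rw [mem_closedBall_zero_iff]
    exact norm_ofNormedAddCommGroup_le _ zero_le_one _
  have := hc hF
  rw [Set.mem_smul_set_iff_inv_smul_mem₀ hc0] at this ⊢
  rw [Set.mem_preimage, map_smul] at this
  exact this

theorem Cp.isBarrel_of_functionallyBounded (S : Set Z)
    (hS : ∀ f : Z → ℝ, Continuous f → ∃ C, ∀ z ∈ S, |f z| ≤ C) :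
    IsBarrel {f : Cp Z | ∀ z ∈ S, |f.1 z| ≤ 1} := by
  refine ⟨?_, ⟨?_, ?_⟩, ?_⟩
  · simp only [Set.ofPred_forall]
    exact isClosed_iInter fun z => isClosed_iInter fun _ =>
      isClosed_le (Cp.continuous_eval z).abs continuous_const
  · intro a ha
    rintro _ ⟨f, hf, rfl⟩ z hz
    simp only [Submodule.coe_smul, Pi.smul_apply, smul_eq_mul, abs_mul]
    exact mul_le_one₀ ha (abs_nonneg _) (hf z hz)
  · intro f hf g hg a b ha hb hab z hz
    simp only [Submodule.coe_add, Submodule.coe_smul, Pi.add_apply, Pi.smul_apply, smul_eq_mul]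
    calc |a * f.1 z + b * g.1 z| ≤ |a * f.1 z| + |b * g.1 z| := abs_add_le _ _
      _ = a * |f.1 z| + b * |g.1 z| := by rw [abs_mul, abs_mul, abs_of_nonneg ha, abs_of_nonneg hb]
      _ ≤ a * 1 + b * 1 := by gcongr; exacts [hf z hz, hg z hz]
      _ = 1 := by linarith
  · intro f
    obtain ⟨C, hC⟩ := hS f.1 f.2
    have h1 : ∀ᶠ c : ℝ in Bornology.cobounded ℝ, max C 1 ≤ ‖c‖ :=
      tendsto_norm_cobounded_atTop.eventually_ge_atTop _
    filter_upwards [h1, Bornology.eventually_ne_cobounded (0 : ℝ)] with c hc hc0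
    rw [Set.singleton_subset_iff, Set.mem_smul_set_iff_inv_smul_mem₀ hc0]
    intro z hz
    simp only [Submodule.coe_smul, Pi.smul_apply, smul_eq_mul, abs_mul, abs_inv]
    rw [inv_mul_le_iff₀ (abs_pos.2 hc0), mul_one]
    exact (hC z hz).trans ((le_max_left _ _).trans hc)

/-- Every continuous linear functional on `C_p(Z)` is a finitely supported measure. -/
theorem Cp.exists_eq_sum (φ : StrongDual ℝ (Cp Z)) :
    ∃ (s : Finset Z) (a : Z → ℝ), (∀ z ∈ s, a z ≠ 0) ∧ ∀ f : Cp Z, φ f = ∑ z ∈ s, a z * f.1 z := by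
  let e : Z → (Cp Z →ₗ[ℝ] ℝ) := fun z => (LinearMap.proj z).comp (Cp Z).subtype
  have h : φ.toLinearMap ∈ Submodule.span ℝ (Set.range e) := by
    -- The topology of `C_p(Z)` is the initial one for the evaluations, so the continuous
    -- functionals are exactly their span.
    rw [LinearMap.mem_span_iff_continuous]
    have h := φ.continuous
    convert h using 1
    rw [instTopologicalSpaceSubtype, Pi.topologicalSpace, induced_iInf]
    simp only [induced_compose]
    all_goals rfl
  obtain ⟨c, hc⟩ := (Finsupp.mem_span_range_iff_exists_finsupp).1 h
  refine ⟨c.support, c, fun z hz => by simpa using hz, fun f => ?_⟩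
  have := congrArg (fun ψ : Cp Z →ₗ[ℝ] ℝ => ψ f) hc
  simp only [Finsupp.sum, LinearMap.sum_apply, LinearMap.smul_apply] at this
  exact this.symm

theorem hasJNP_Cp_iff [T35Space Z] : HasJNP (Cp Z) ↔ HasJNSequence Z := by
  rw [hasJNP_iff_exists_seq]
  constructor
  · rintro ⟨φ, hφ, B, hB, hn⟩
    choose s a ha hsa using fun n => Cp.exists_eq_sum (φ n)
    have h0 : ∀ f : Z → ℝ, Continuous f → Tendsto (fun n => ∑ z ∈ s n, a n z * f z) atTop (𝓝 0) :=
      fun f hf => by simpa only [hsa] using hφ ⟨f, hf⟩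
    refine ⟨s, a, h0, fun hl => hn ?_⟩
    have hS : ∀ f : Z → ℝ, Continuous f → ∃ C, ∀ z ∈ ⋃ n, (s n : Set Z), |f z| ≤ C := by
      intro f hf
      obtain ⟨C, hC⟩ := exists_abs_le_on_support s a (fun f hf => by
        obtain ⟨C, hC⟩ := (h0 f hf).norm.bddAbove_range
        exact ⟨C, fun n => hC ⟨n, rfl⟩⟩) f hf
      refine ⟨C, fun z hz => ?_⟩
      obtain ⟨n, hz⟩ := Set.mem_iUnion.1 hz
      exact hC n z hz (ha n z hz)
    -- The polar of the union of the supports absorbs `B`, which bounds all `f ∈ B` there by one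
    -- constant `|c|`; the ℓ¹ norms then control the convergence on `B`.
    have hab := hB _ (Cp.isBarrel_of_functionallyBounded _ hS)
    obtain ⟨c, hc, hc0⟩ := (hab.and (Bornology.eventually_ne_cobounded (0 : ℝ))).exists
    rw [Metric.tendstoUniformlyOn_iff]
    intro ε hε
    have hl' : Tendsto (fun n => |c| * ∑ z ∈ s n, |a n z|) atTop (𝓝 0) := by
      simpa using hl.const_mul |c|
    filter_upwards [hl'.eventually_lt_const hε] with n hn f hf
    rw [Pi.zero_apply, dist_zero_left, hsa, Real.norm_eq_abs]
    refine lt_of_le_of_lt ?_ hn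
    rw [Finset.mul_sum]
    refine (Finset.abs_sum_le_sum_abs _ _).trans (Finset.sum_le_sum fun z hz => ?_)
    have h1 := hc hf
    rw [Set.mem_smul_set_iff_inv_smul_mem₀ hc0] at h1
    have h2 := h1 z (Set.mem_iUnion.2 ⟨n, hz⟩)
    simp only [Submodule.coe_smul, Pi.smul_apply, smul_eq_mul, abs_mul, abs_inv] at h2
    rw [inv_mul_le_iff₀ (abs_pos.2 hc0), mul_one] at h2
    rw [abs_mul, mul_comm]
    gcongr
  · rintro ⟨s, a, h0, hl⟩
    let φ : ℕ → StrongDual ℝ (Cp Z) := fun n => ∑ z ∈ s n, a n z •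
      (⟨(LinearMap.proj z).comp (Cp Z).subtype, Cp.continuous_eval z⟩ : StrongDual ℝ (Cp Z))
    have hφ : ∀ n (f : Cp Z), φ n f = ∑ z ∈ s n, a n z * f.1 z := fun n f => by
      simp only [φ, sum_apply, smul_apply]
      rfl
    refine ⟨φ, fun f => by simpa only [hφ] using h0 f.1 f.2, _, Cp.isBarrelBounded_unitBall,
      fun hu => hl ?_⟩
    rw [Metric.tendstoUniformlyOn_iff] at hu
    rw [Metric.tendsto_atTop']
    intro ε hε
    obtain ⟨N, hN⟩ := (hu ε hε).exists_forall_of_atTop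
    refine ⟨N, fun n hn => ?_⟩
    obtain ⟨f, hf, hf1, hfs⟩ := exists_continuous_sum_mul_eq_sum_abs (s n) (a n)
    have := hN n hn.le ⟨f, hf⟩ hf1
    rw [hφ] at this
    dsimp only at this
    rw [hfs] at this
    rw [dist_comm]
    exact this

end

/-! ### The topology σ and its functionally bounded sets -/

section

variable {X Y : Type*} [TopologicalSpace X] [TopologicalSpace Y]

theorem ProdSigma.continuous_of_isSeparatelyContinuous {f : X × Y → ℝ}
    (hf : IsSeparatelyContinuous f) : Continuous (X := ProdSigma X Y) f :=
  continuous_iInf_dom (i := (⟨f, hf⟩ : {f : X × Y → ℝ // IsSeparatelyContinuous f}))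
    continuous_induced_dom

theorem ProdSigma.continuous_mk_left (x : X) :
    Continuous (Y := ProdSigma X Y) fun y : Y => ((x, y) : X × Y) :=
  continuous_iInf_rng.2 fun f => continuous_induced_rng.2 (f.2.1 x)

theorem ProdSigma.continuous_mk_right (y : Y) :
    Continuous (Y := ProdSigma X Y) fun x : X => ((x, y) : X × Y) :=
  continuous_iInf_rng.2 fun f => continuous_induced_rng.2 (f.2.2 y)

theorem ProdSigma.continuous_iff {f : X × Y → ℝ} :
    Continuous (X := ProdSigma X Y) f ↔ IsSeparatelyContinuous f :=
  ⟨fun hf => ⟨fun x => hf.comp (continuous_mk_left x), fun y => hf.comp (continuous_mk_right y)⟩,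
    continuous_of_isSeparatelyContinuous⟩

theorem IsSeparatelyContinuous.of_mul {u : X → ℝ} {v : Y → ℝ} (hu : Continuous u)
    (hv : Continuous v) : IsSeparatelyContinuous fun p : X × Y => u p.1 * v p.2 :=
  ⟨fun _ => by fun_prop, fun _ => by fun_prop⟩

theorem IsSeparatelyContinuous.swap {f : X × Y → ℝ} (hf : IsSeparatelyContinuous f) :
    IsSeparatelyContinuous fun p : Y × X => f p.swap :=
  ⟨hf.2, hf.1⟩

instance ProdSigma.instT35Space [T35Space X] [T35Space Y] : T35Space (ProdSigma X Y) := by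
  have h1 : CompletelyRegularSpace (ProdSigma X Y) :=
    completelyRegularSpace_iInf fun f => completelyRegularSpace_induced inferInstance _
  have h2 : T0Space (ProdSigma X Y) := by
    refine ⟨fun p q hpq => ?_⟩
    have key : ∀ f : X × Y → ℝ, IsSeparatelyContinuous f → f p = f q := fun f hf =>
      (hpq.map (continuous_of_isSeparatelyContinuous hf)).eq
    by_contra hne
    by_cases hx : p.1 = q.1
    · have hy : p.2 ≠ q.2 := fun hy => hne (Prod.ext hx hy)
      obtain ⟨v, hv, -, hv1, hv0⟩ := exists_continuous_bump {q.2} p.2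
      have := key _ (.of_mul (continuous_const (y := (1 : ℝ))) hv)
      simp [hv1, hv0 q.2 (by simp) hy.symm] at this
    · obtain ⟨u, hu, -, hu1, hu0⟩ := exists_continuous_bump {q.1} p.1
      have := key _ (.of_mul hu (continuous_const (y := (1 : ℝ))))
      simp [hu1, hu0 q.1 (by simp) (Ne.symm hx)] at this
  exact { h2, h1 with }

/-- A continuous injection carries Josefson--Nissenzweig sequences to such sequences. -/
theorem HasJNSequence.map {Z W : Type*} [TopologicalSpace Z] [TopologicalSpace W]
    (h : HasJNSequence Z) (e : Z ↪ W) (he : Continuous e) : HasJNSequence W := by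
  obtain ⟨s, a, h0, hl⟩ := h
  refine ⟨fun n => (s n).map e, fun n => Function.extend e (a n) 0, fun f hf => ?_, ?_⟩
  · simpa [Finset.sum_map, e.injective.extend_apply] using h0 (fun z => f (e z)) (hf.comp he)
  · simpa [Finset.sum_map, e.injective.extend_apply] using hl

/-- An infinite Hausdorff space contains an infinite discrete subspace, whose points are separated
by functions `f k`. -/
theorem exists_disjoint_bumps [T35Space X] (x : ℕ → X) (hx : Function.Injective x) :
    ∃ (ψ : ℕ → ℕ) (u : ℕ → X → ℝ), Function.Injective ψ ∧ (∀ k, Continuous (u k)) ∧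
      (∀ k, u k (x (ψ k)) ≠ 0) ∧ ∀ j k z, j ≠ k → u j z = 0 ∨ u k z = 0 := by
  have : Infinite (Set.range x) := Set.infinite_coe_iff.2 (Set.infinite_range_of_injective hx)
  obtain ⟨e, he⟩ := exists_topology_isEmbedding_nat (Set.range x)
  choose ψ hψ using fun k => (e k).2
  have hψi : Function.Injective ψ := fun i j hij =>
    he.injective (Subtype.ext (by rw [← hψ i, ← hψ j, hij]))
  have he' : IsEmbedding fun k => x (ψ k) := by
    simpa only [hψ] using! IsEmbedding.subtypeVal.comp he
  have hf : ∀ k, ∃ f : X → ℝ, Continuous f ∧ f (x (ψ k)) = 1 ∧ ∀ j, j ≠ k → f (x (ψ j)) = 0 := by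
    intro k
    obtain ⟨U, hU, hUk⟩ := he'.isOpen_iff.1 (isOpen_discrete {k})
    have hkU : x (ψ k) ∈ U := by
      have : k ∈ (fun k => x (ψ k)) ⁻¹' U := hUk ▸ rfl
      exact this
    obtain ⟨f, hf, h0, h1⟩ := CompletelyRegularSpace.completely_regular (x (ψ k)) Uᶜ
      hU.isClosed_compl (by simpa using hkU)
    refine ⟨fun z => 1 - f z, by fun_prop, by simp [h0], fun j hj => ?_⟩
    have : x (ψ j) ∈ Uᶜ := fun hjU => hj (by
      have : j ∈ (fun k => x (ψ k)) ⁻¹' U := hjU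
      rwa [hUk] at this)
    simp [h1 this]
  choose f hfc hf1 hf0 using hf
  -- The first factor needs `f k > 1/2`, the product needs `f j < 1/2` for all `j < k`; this forces
  -- disjointness.
  refine ⟨ψ, fun k z => max (f k z - 1 / 2) 0 * ∏ j ∈ Finset.range k, max (1 / 2 - f j z) 0,
    hψi, fun k => ?_, fun k => ?_, ?_⟩
  · have := hfc
    fun_prop
  · refine mul_ne_zero (by rw [hf1]; norm_num) (Finset.prod_ne_zero_iff.2 fun j hj => ?_)
    rw [hf0 j k (Finset.mem_range.1 hj).ne']
    norm_num
  · have key : ∀ j k z, j < k →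
        max (f j z - 1 / 2) 0 * ∏ i ∈ Finset.range j, max (1 / 2 - f i z) 0 = 0 ∨
        max (f k z - 1 / 2) 0 * ∏ i ∈ Finset.range k, max (1 / 2 - f i z) 0 = 0 := by
      intro j k z hjk
      rcases le_total (f j z) (1 / 2) with h | h
      · left
        rw [max_eq_right (by linarith), zero_mul]
      · right
        rw [Finset.prod_eq_zero (Finset.mem_range.2 hjk) (max_eq_right (by linarith)), mul_zero]
    intro j k z hjk
    rcases lt_or_gt_of_ne hjk with h | h
    · exact key j k z h
    · exact (key k j z h).symm

/-- Fixing either coordinate leaves at most one nonzero term, so no local finiteness is needed. -/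
theorem isSeparatelyContinuous_tsum (u : ℕ → X → ℝ) (v : ℕ → Y → ℝ)
    (hu : ∀ k, Continuous (u k)) (hv : ∀ k, Continuous (v k))
    (hud : ∀ j k z, j ≠ k → u j z = 0 ∨ u k z = 0) (hvd : ∀ j k z, j ≠ k → v j z = 0 ∨ v k z = 0) :
    IsSeparatelyContinuous fun p : X × Y => ∑' k, u k p.1 * v k p.2 := by
  constructor
  · intro x
    dsimp only
    by_cases h : ∃ k, u k x ≠ 0
    · obtain ⟨k, hk⟩ := h
      have : ∀ y, ∑' j, u j x * v j y = u k x * v k y := fun y => tsum_eq_single k fun j hj => by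
        rw [(hud j k x hj).resolve_right hk, zero_mul]
      simp only [this]
      exact (hv k).const_mul _
    · push Not at h
      simp [h, continuous_const]
  · intro y
    dsimp only
    by_cases h : ∃ k, v k y ≠ 0
    · obtain ⟨k, hk⟩ := h
      have : ∀ x, ∑' j, u j x * v j y = u k x * v k y := fun x => tsum_eq_single k fun j hj => by
        rw [(hvd j k y hj).resolve_right hk, mul_zero]
      simp only [this]
      exact (hu k).mul_const _
    · push Not at h
      simp [h, continuous_const]

/-- A sequence in `X × Y` which is injective in both coordinates is not functionally bounded for
the separately continuous functions. -/
theorem exists_isSeparatelyContinuous_unbounded [T35Space X] [T35Space Y] (p : ℕ → X × Y)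
    (h1 : Function.Injective fun n => (p n).1) (h2 : Function.Injective fun n => (p n).2) :
    ∃ f : X × Y → ℝ, IsSeparatelyContinuous f ∧ ∀ C, ∃ n, C < |f (p n)| := by
  obtain ⟨ψ, u, hψ, hu, hu1, hud⟩ := exists_disjoint_bumps _ h1
  obtain ⟨χ, v, hχ, hv, hv1, hvd⟩ := exists_disjoint_bumps _ (h2.comp hψ)
  simp only [Function.comp_apply] at hv1
  let q : ℕ → X × Y := fun k => p (ψ (χ k))
  -- Normalised so that the sum takes the value `k` at `q k`.
  let c : ℕ → ℝ := fun k => k / (u (χ k) (q k).1 * v k (q k).2)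
  refine ⟨_, isSeparatelyContinuous_tsum (fun k x => c k * u (χ k) x) v
    (fun k => (hu _).const_mul _) hv (fun j k z hjk => ?_) hvd, fun C => ?_⟩
  · exact (hud _ _ z (hχ.ne hjk)).imp (fun h => by rw [h, mul_zero]) fun h => by rw [h, mul_zero]
  · obtain ⟨k, hk⟩ := exists_nat_gt C
    refine ⟨ψ (χ k), ?_⟩
    rw [tsum_eq_single k fun j hj => by
      rw [(hvd j k _ hj).resolve_right (hv1 k), mul_zero]]
    have hne : u (χ k) (q k).1 * v k (q k).2 ≠ 0 := mul_ne_zero (hu1 _) (hv1 k)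
    have : c k * u (χ k) (q k).1 * v k (q k).2 = k := by
      rw [mul_assoc]
      exact div_mul_cancel₀ _ hne
    change C < |c k * u (χ k) (q k).1 * v k (q k).2|
    rwa [this, Nat.abs_cast]

/-- A set in `X × Y` that is functionally bounded for the separately continuous functions is
covered by finitely many vertical and horizontal lines. -/
theorem exists_finset_cover_of_functionallyBounded [T35Space X] [T35Space Y] (S : Set (X × Y))
    (hS : ∀ f : X × Y → ℝ, IsSeparatelyContinuous f → ∃ C, ∀ p ∈ S, |f p| ≤ C) :
    ∃ (F : Finset X) (G : Finset Y), ∀ p ∈ S, p.1 ∈ F ∨ p.2 ∈ G := by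
  classical
  by_contra! h
  obtain ⟨p, hpS, hp⟩ := exists_seq_of_forall_finset_exists (fun p => p ∈ S)
    (fun p q : X × Y => p.1 ≠ q.1 ∧ p.2 ≠ q.2) (fun M _ => by
      obtain ⟨q, hq, hq1, hq2⟩ := h (M.image Prod.fst) (M.image Prod.snd)
      exact ⟨q, hq, fun r hr => ⟨fun e => hq1 (e ▸ Finset.mem_image_of_mem _ hr),
        fun e => hq2 (e ▸ Finset.mem_image_of_mem _ hr)⟩⟩)
  obtain ⟨f, hf, hfu⟩ := exists_isSeparatelyContinuous_unbounded p
    (.of_lt_imp_ne fun m n hmn => (hp m n hmn).1)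
    (.of_lt_imp_ne fun m n hmn => (hp m n hmn).2)
  obtain ⟨C, hC⟩ := hS f hf
  obtain ⟨n, hn⟩ := hfu C
  exact hn.not_ge (hC _ (hpS n))

end

/-! ### Measures carried by finitely many lines -/

section

variable {X Y : Type*} [TopologicalSpace X] [TopologicalSpace Y] [T35Space X] [T35Space Y]

open Classical in
-- Multiplying by a bump at `x` isolates the line over `x`, but only for test functions vanishing on
-- `G`. Balancing atoms on `G` extend the convergence to all test functions on `Y`.
theorem tendsto_vertical_mass (hY : ¬ HasJNSequence Y) (s : ℕ → Finset (X × Y))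
    (a : ℕ → X × Y → ℝ)
    (h0 : ∀ f : X × Y → ℝ, IsSeparatelyContinuous f →
      Tendsto (fun n => ∑ p ∈ s n, a n p * f p) atTop (𝓝 0))
    (F : Finset X) (G : Finset Y) (hc : ∀ n, ∀ p ∈ s n, p.1 ∈ F ∨ p.2 ∈ G) (x : X) :
    Tendsto (fun n => ∑ p ∈ s n with p.1 = x ∧ p.2 ∉ G, |a n p|) atTop (𝓝 0) := by
  obtain ⟨u, hu, -, hu1, hu0⟩ := exists_continuous_bump F x
  choose v hv _ hv1 hv0 using fun y => exists_continuous_bump G y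
  let t : ℕ → Finset (X × Y) := fun n => {p ∈ s n | p.1 = x ∧ p.2 ∉ G}
  have ht : ∀ n, ∀ p ∈ t n, p.1 = x ∧ p.2 ∉ G := fun n p hp => (Finset.mem_filter.1 hp).2
  let T : ℕ → Finset Y := fun n => (t n).image Prod.snd
  have hTsum : ∀ n (h : X × Y → ℝ), ∑ p ∈ t n, h p = ∑ y ∈ T n, h (x, y) := fun n h => by
    rw [Finset.sum_image fun p hp q hq hpq => Prod.ext ((ht n p hp).1.trans (ht n q hq).1.symm) hpq]
    exact Finset.sum_congr rfl fun p hp => by rw [← (ht n p hp).1]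
  have hTG : ∀ n, Disjoint (T n) G := fun n => Finset.disjoint_left.2 fun y hy => by
    obtain ⟨p, hp, rfl⟩ := Finset.mem_image.1 hy
    exact (ht n p hp).2
  have hvan : ∀ f : Y → ℝ, Continuous f → (∀ y ∈ G, f y = 0) →
      Tendsto (fun n => ∑ y ∈ T n, a n (x, y) * f y) atTop (𝓝 0) := by
    intro f hf hfG
    refine (h0 _ (.of_mul hu hf)).congr fun n => ?_
    rw [← hTsum n fun p => a n p * f p.2]
    rw [← Finset.sum_subset (Finset.filter_subset _ _ : t n ⊆ s n) fun p hp hpt => ?_]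
    · refine Finset.sum_congr rfl fun p hp => ?_
      rw [(ht n p hp).1, hu1, one_mul]
    · by_cases hG : p.2 ∈ G
      · rw [hfG _ hG, mul_zero, mul_zero]
      · have hx : p.1 ≠ x := fun hx => hpt (Finset.mem_filter.2 ⟨hp, hx, hG⟩)
        rw [hu0 _ ((hc n p hp).resolve_right hG) hx, zero_mul, mul_zero]
  -- Pairing `f` with `b n` equals pairing `f - ∑ y' ∈ G, f y' * v y'`, which vanishes on `G`, with
  -- the mass on `T n`.
  let b : ℕ → Y → ℝ := fun n y =>
    if y ∈ G then -∑ y' ∈ T n, a n (x, y') * v y y' else a n (x, y)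
  have hbT : ∀ n, ∀ y ∈ T n, b n y = a n (x, y) := fun n y hy =>
    if_neg (Finset.disjoint_left.1 (hTG n) hy)
  have hb : Tendsto (fun n => ∑ y ∈ T n ∪ G, |b n y|) atTop (𝓝 0) := by
    by_contra hcon
    refine hY ⟨_, b, fun f hf => ?_, hcon⟩
    refine (hvan (fun y => f y - ∑ y' ∈ G, f y' * v y' y) (by fun_prop) fun y hy => ?_).congr
      fun n => ?_
    · rw [Finset.sum_eq_single_of_mem y hy fun y' _ hne => by
        rw [hv0 y' y hy hne.symm, mul_zero], hv1, mul_one, sub_self]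
    · have h1 : ∑ y ∈ T n, b n y * f y = ∑ y ∈ T n, a n (x, y) * f y :=
        Finset.sum_congr rfl fun y hy => by rw [hbT n y hy]
      rw [Finset.sum_union (hTG n), h1]
      have : ∑ y ∈ G, b n y * f y = -∑ y ∈ G, ∑ y' ∈ T n, a n (x, y') * (f y * v y y') := by
        rw [← Finset.sum_neg_distrib]
        refine Finset.sum_congr rfl fun y hy => ?_
        simp only [b, if_pos hy, neg_mul, Finset.sum_mul]
        congr 1
        exact Finset.sum_congr rfl fun _ _ => by ring
      rw [this, Finset.sum_comm]
      simp only [mul_sub, Finset.mul_sum, Finset.sum_sub_distrib]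
      ring
  refine squeeze_zero (fun n => Finset.sum_nonneg fun _ _ => abs_nonneg _) (fun n => ?_) hb
  refine (hTsum n fun p => |a n p|).trans_le ?_
  rw [Finset.sum_congr rfl fun y hy => by rw [← hbT n y hy]]
  exact Finset.sum_le_sum_of_subset_of_nonneg Finset.subset_union_left fun _ _ _ => abs_nonneg _

open Classical in
theorem tendsto_horizontal_mass (hX : ¬ HasJNSequence X) (s : ℕ → Finset (X × Y))
    (a : ℕ → X × Y → ℝ)
    (h0 : ∀ f : X × Y → ℝ, IsSeparatelyContinuous f →
      Tendsto (fun n => ∑ p ∈ s n, a n p * f p) atTop (𝓝 0))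
    (F : Finset X) (G : Finset Y) (hc : ∀ n, ∀ p ∈ s n, p.1 ∈ F ∨ p.2 ∈ G) (y : Y) :
    Tendsto (fun n => ∑ p ∈ s n with p.2 = y ∧ p.1 ∉ F, |a n p|) atTop (𝓝 0) := by
  have h := tendsto_vertical_mass hX (fun n => (s n).map (Equiv.prodComm X Y).toEmbedding)
    (fun n p => a n p.swap)
    (fun f hf => by simpa [Finset.sum_map] using h0 _ hf.swap) G F
    (fun n p hp => by
      obtain ⟨q, hq, rfl⟩ := Finset.mem_map.1 hp
      exact (hc n q hq).symm) y
  simp only [Finset.sum_filter, Finset.sum_map, Equiv.coe_toEmbedding, Equiv.prodComm_apply,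
    Prod.swap_swap, Prod.fst_swap, Prod.snd_swap] at h ⊢
  convert h

open Classical in
-- Off the grid `F ×ˢ G` the mass is a finite sum of line masses. A product of bumps then reads off
-- the coefficient at a grid point, up to an error bounded by the off-grid mass.
theorem tendsto_sum_abs_of_cross (hX : ¬ HasJNSequence X) (hY : ¬ HasJNSequence Y)
    (s : ℕ → Finset (X × Y)) (a : ℕ → X × Y → ℝ)
    (h0 : ∀ f : X × Y → ℝ, IsSeparatelyContinuous f →
      Tendsto (fun n => ∑ p ∈ s n, a n p * f p) atTop (𝓝 0))
    (F : Finset X) (G : Finset Y) (hc : ∀ n, ∀ p ∈ s n, p.1 ∈ F ∨ p.2 ∈ G) :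
    Tendsto (fun n => ∑ p ∈ s n, |a n p|) atTop (𝓝 0) := by
  have hout : Tendsto (fun n => ∑ p ∈ s n with p ∉ F ×ˢ G, |a n p|) atTop (𝓝 0) := by
    have h1 := (tendsto_finsetSum F fun x _ => tendsto_vertical_mass hY s a h0 F G hc x).add
      (tendsto_finsetSum G fun y _ => tendsto_horizontal_mass hX s a h0 F G hc y)
    simp only [Finset.sum_const_zero, add_zero] at h1
    refine squeeze_zero (fun n => Finset.sum_nonneg fun _ _ => abs_nonneg _) (fun n => ?_) h1
    simp only [Finset.sum_filter]
    rw [Finset.sum_comm, Finset.sum_comm (s := G), ← Finset.sum_add_distrib]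
    refine Finset.sum_le_sum fun p hp => ?_
    have hn1 : ∀ x ∈ F, 0 ≤ if p.1 = x ∧ p.2 ∉ G then |a n p| else 0 := fun x _ => by
      split_ifs <;> positivity
    have hn2 : ∀ y ∈ G, 0 ≤ if p.2 = y ∧ p.1 ∉ F then |a n p| else 0 := fun y _ => by
      split_ifs <;> positivity
    by_cases hpF : p.1 ∈ F
    · refine le_add_of_le_of_nonneg (le_trans ?_ (Finset.single_le_sum hn1 hpF))
        (Finset.sum_nonneg hn2)
      simp [hpF]
    · refine le_add_of_nonneg_of_le (Finset.sum_nonneg hn1)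
        (le_trans ?_ (Finset.single_le_sum hn2 ((hc n p hp).resolve_left hpF)))
      simp [hpF]
  have hin : Tendsto (fun n => ∑ p ∈ s n with p ∈ F ×ˢ G, |a n p|) atTop (𝓝 0) := by
    have hq : ∀ q ∈ F ×ˢ G, Tendsto (fun n => if q ∈ s n then |a n q| else 0) atTop (𝓝 0) := by
      rintro ⟨x, y⟩ hxy
      obtain ⟨u, hu, hub, hu1, hu0⟩ := exists_continuous_bump F x
      obtain ⟨v, hv, hvb, hv1, hv0⟩ := exists_continuous_bump G y
      have h1 := (h0 _ (.of_mul hu hv)).abs.add hout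
      simp only [abs_zero, add_zero] at h1
      refine squeeze_zero (fun n => by split_ifs <;> positivity) (fun n => ?_) h1
      have h2 : ∑ p ∈ s n with p ∈ F ×ˢ G, a n p * (u p.1 * v p.2) =
          if (x, y) ∈ s n then a n (x, y) else 0 := by
        have h : ∀ p ∈ {p ∈ s n | p ∈ F ×ˢ G}, a n p * (u p.1 * v p.2) =
            if p = (x, y) then a n p else 0 := fun p hp => by
          have hp := Finset.mem_product.1 (Finset.mem_filter.1 hp).2
          split_ifs with hpe
          · simp [hpe, hu1, hv1]
          · by_cases hx : p.1 = x
            · rw [hv0 p.2 hp.2 fun hy => hpe (Prod.ext hx hy), mul_zero, mul_zero]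
            · rw [hu0 p.1 hp.1 hx, zero_mul, mul_zero]
        rw [Finset.sum_congr rfl h, Finset.sum_ite_eq']
        simp only [Finset.mem_filter, hxy, and_true]
      have h3 : |∑ p ∈ s n with p ∉ F ×ˢ G, a n p * (u p.1 * v p.2)| ≤
          ∑ p ∈ s n with p ∉ F ×ˢ G, |a n p| := by
        refine (Finset.abs_sum_le_sum_abs _ _).trans (Finset.sum_le_sum fun p _ => ?_)
        rw [abs_mul]
        refine mul_le_of_le_one_right (abs_nonneg _) (abs_le.2 ⟨?_, ?_⟩)
        · linarith [mul_nonneg (hub p.1).1 (hvb p.2).1]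
        · exact mul_le_one₀ (hub p.1).2 (hvb p.2).1 (hvb p.2).2
      have h4 := Finset.sum_filter_add_sum_filter_not (s n) (fun p => p ∈ F ×ˢ G)
        (fun p => a n p * (u p.1 * v p.2))
      rw [h2] at h4
      rw [← h4]
      have h5 : (if (x, y) ∈ s n then |a n (x, y)| else 0) =
          |if (x, y) ∈ s n then a n (x, y) else 0| := by split_ifs <;> simp
      rw [h5]
      set A := if (x, y) ∈ s n then a n (x, y) else 0
      set B := ∑ p ∈ s n with p ∉ F ×ˢ G, a n p * (u p.1 * v p.2)
      have := abs_sub_abs_le_abs_add A B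
      linarith
    have := tendsto_finsetSum (F ×ˢ G) hq
    rw [Finset.sum_const_zero] at this
    refine this.congr fun n => ?_
    rw [← Finset.sum_filter]
    congr 1
    ext p
    simp [and_comm]
  have := hin.add hout
  rw [add_zero] at this
  exact this.congr fun n => Finset.sum_filter_add_sum_filter_not _ _ _

theorem hasJNSequence_prodSigma_iff [Nonempty X] [Nonempty Y] :
    HasJNSequence (ProdSigma X Y) ↔ HasJNSequence X ∨ HasJNSequence Y := by
  classical
  constructor
  · rintro ⟨s, a, h0, hl⟩
    by_contra! hXY
    have hb : ∀ f : ProdSigma X Y → ℝ, Continuous f →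
        ∃ C, ∀ n, |∑ z ∈ s n, a n z * f z| ≤ C := fun f hf => by
      obtain ⟨C, hC⟩ := (h0 f hf).norm.bddAbove_range
      exact ⟨C, fun n => hC ⟨n, rfl⟩⟩
    obtain ⟨F, G, hFG⟩ := exists_finset_cover_of_functionallyBounded (X := X) (Y := Y)
      {p | ∃ n, p ∈ s n ∧ a n p ≠ 0} fun f hf => by
        obtain ⟨C, hC⟩ := exists_abs_le_on_support s a hb f (ProdSigma.continuous_iff.2 hf)
        exact ⟨C, fun p ⟨n, hp, hne⟩ => hC n p hp hne⟩
    -- Zero coefficients are discarded first, since the lines cover only the true supports.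
    refine hl ((tendsto_sum_abs_of_cross hXY.1 hXY.2 (fun n => {p ∈ s n | a n p ≠ 0}) a
      (fun f hf => (h0 f (ProdSigma.continuous_iff.2 hf)).congr fun n => ?_) F G
      fun n p hp => hFG p ⟨n, Finset.mem_filter.1 hp⟩).congr fun n => ?_)
    · exact (Finset.sum_filter_of_ne fun p _ hp => left_ne_zero_of_mul hp).symm
    · exact Finset.sum_filter_of_ne fun p _ hp => abs_ne_zero.1 hp
  · rintro (h | h)
    · obtain ⟨y⟩ := ‹Nonempty Y›
      exact h.map ⟨fun x => ((x, y) : X × Y), fun _ _ h => congrArg Prod.fst h⟩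
        (ProdSigma.continuous_mk_right y)
    · obtain ⟨x⟩ := ‹Nonempty X›
      exact h.map ⟨fun y => ((x, y) : X × Y), fun _ _ h => congrArg Prod.snd h⟩
        (ProdSigma.continuous_mk_left x)

end

theorem mainTheorem3 {X Y : Type*} [TopologicalSpace X] [TopologicalSpace Y]
    [T35Space X] [T35Space Y] [Infinite X] [Infinite Y] :
    HasJNP (Cp (ProdSigma X Y)) ↔ (HasJNP (Cp X) ∨ HasJNP (Cp Y)) := by
  rw [hasJNP_Cp_iff, hasJNP_Cp_iff, hasJNP_Cp_iff, hasJNSequence_prodSigma_iff]
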